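/- All manifolds are finite-dimensional, real, smooth, without boundary. Let $\Gamma\rightrightarrows Q$ be a Lie groupoid with $\Gamma$ Hausdorff: source $\alpha$ and target $\beta:\Gamma\to Q$ (smooth submersions), identity section $\varepsilon:Q\to\Gamma$, inversion $\iota:\Gamma\to\Gamma$, and multiplication $\nu(g,h)=gh$ defined on $\Gamma_2=\{(g,h)\in\Gamma\times\Gamma:\beta(g)=\alpha(h)\}$, all smooth and satisfying the groupoid axioms. Suppose that $\Gamma\rightrightarrows Q$ is a Poisson groupoid, that is, $\Gamma$ carries a Poisson bracket $\{\cdot,\cdot\}$ on $C^\infty(\Gamma)$ such that the graph $\{(g,h,gh):(g,h)\in\Gamma_2\}$ is a coisotropic submanifold of $\Gamma\times\Gamma\times\Gamma^-$, where $\Gamma^-$ denotes $\Gamma$ with the bracket $-\{\cdot,\cdot\}$. (A submanifold $S$ of a Poisson manifold is coisotropic if for every $p\in S$ the map $\sharp: T^*_p\to T_p$ of the Poisson structure, determined by $\sharp(dg)(f)=\{f,g\}$, maps the annihilator of $T_pS$ into $T_pS$.) Let $E:\Gamma\to\mathbb R$ be a smooth function with $E\circ\iota=-E$, and let $X_E$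 be its Hamiltonian vector field, defined by $X_E(F)=\{F,E\}$ for all $F\in C^\infty(\Gamma)$. Then $$X_E(\varepsilon(q))\in T_{\varepsilon(q)}\,\varepsilon(Q)\qquad\text{for all } q\in Q.$$ -/

import Mathlib

open scoped Manifold ContDiff Topology
open MeasureTheory Set

theorem exists_smooth_taylor_remainder {E : Type*} [NormedAddCommGroup E] [NormedSpace ℝ E]
    {f : E → ℝ} (hf : ContDiff ℝ ∞ f) (a : E) :
    ∃ g : E → (E →L[ℝ] ℝ), ContDiff ℝ ∞ g ∧ g a = fderiv ℝ f a ∧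
      ∀ x, f x = f a + g x (x - a) := by
  have hdf : ContDiff ℝ ∞ (fderiv ℝ f) := hf.fderiv_right (by simp)
  let φ : ContDiffBump (0 : ℝ) := ⟨1, 2, by norm_num, by norm_num⟩
  let G : E → ℝ → (E →L[ℝ] ℝ) := fun p s => φ s • fderiv ℝ f (a - s • (p - a))
  let w : ℝ → ℝ := indicator (Icc 0 1) 1
  have key := contDiffOn_convolution_right_with_param_comp (μ := volume) (n := ⊤)
    (ContinuousLinearMap.lsmul ℝ ℝ : ℝ →L[ℝ] (E →L[ℝ] ℝ) →L[ℝ] (E →L[ℝ] ℝ))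
    (s := (univ : Set E)) (v := fun _ : E => (0 : ℝ)) contDiffOn_const (f := w) (g := G)
    (k := Metric.closedBall 0 2) isOpen_univ (isCompact_closedBall _ _)
    (by
      intro p x _ hx
      have : φ x = 0 := φ.zero_of_le_dist (by
        have := Metric.mem_closedBall.not.1 hx
        exact (not_le.1 this).le)
      simp [G, this])
    (by
      apply Integrable.locallyIntegrable
      rw [integrable_indicator_iff measurableSet_Icc]
      exact integrableOn_const (by simp))
    (by
      apply ContDiff.contDiffOn
      have h1 : ContDiff ℝ ∞ (fun q : E × ℝ => φ q.2) := φ.contDiff.comp contDiff_snd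
      exact h1.smul (hdf.comp (by fun_prop)))
  have hint : ∀ x : E, (convolution w (G x) (ContinuousLinearMap.lsmul ℝ ℝ :
      ℝ →L[ℝ] (E →L[ℝ] ℝ) →L[ℝ] (E →L[ℝ] ℝ)) volume) 0
      = ∫ t in (0:ℝ)..1, fderiv ℝ f (a + t • (x - a)) := by
    intro x
    rw [intervalIntegral.integral_of_le zero_le_one, ← integral_Icc_eq_integral_Ioc,
      ← integral_indicator measurableSet_Icc, convolution_def]
    congr 1
    ext1 t
    by_cases ht : t ∈ Icc (0:ℝ) 1
    · have : φ (-t) = 1 := φ.one_of_mem_closedBall (by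
        simp only [Metric.mem_closedBall, dist_zero_right, norm_neg, Real.norm_eq_abs]
        rw [abs_of_nonneg ht.1]; exact ht.2)
      simp [w, G, ht, this]
    · simp [w, ht]
  refine ⟨fun x => ∫ t in (0:ℝ)..1, fderiv ℝ f (a + t • (x - a)), ?_, by simp, fun x => ?_⟩
  · rw [← contDiffOn_univ]
    exact key.congr fun x _ => (hint x).symm
  · have hc : Continuous fun t : ℝ => fderiv ℝ f (a + t • (x - a)) :=
      hdf.continuous.comp (by fun_prop)
    rw [ContinuousLinearMap.intervalIntegral_apply (hc.intervalIntegrable _ _)]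
    have hd : ∀ t ∈ uIcc (0:ℝ) 1, HasDerivAt (fun t : ℝ => f (a + t • (x - a)))
        (fderiv ℝ f (a + t • (x - a)) (x - a)) t := by
      intro t _
      have h1 : HasDerivAt (fun t : ℝ => a + t • (x - a)) (x - a) t := by
        simpa using ((hasDerivAt_id t).smul_const (x - a)).const_add a
      exact ((hf.differentiable (by simp)) _).hasFDerivAt.comp_hasDerivAt t h1
    rw [intervalIntegral.integral_eq_sub_of_hasDerivAt hd
      ((hc.clm_apply continuous_const).intervalIntegrable _ _)]
    simp

section Differential

variable {E : Type*} [NormedAddCommGroup E] [NormedSpace ℝ E]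
  {H : Type*} [TopologicalSpace H] (I : ModelWithCorners ℝ E H)
  {M : Type*} [TopologicalSpace M] [ChartedSpace H M]

/-- The differential `d_p f : T_p M → ℝ` of a real function `f` at the point `p`. -/
noncomputable def differential (f : M → ℝ) (p : M) : TangentSpace I p →L[ℝ] ℝ :=
  ((NormedSpace.fromTangentSpace (𝕜 := ℝ) (f p)).toContinuousLinearMap).comp
    (mfderiv I 𝓘(ℝ, ℝ) f p)

theorem differential_eq_fderiv [I.Boundaryless] {f : M → ℝ} {p : M}
    (hf : ContMDiff I 𝓘(ℝ, ℝ) ∞ f) {g : E → ℝ}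
    (hg : (f ∘ (extChartAt I p).symm) =ᶠ[𝓝 (extChartAt I p p)] g) :
    (differential I f p : E →L[ℝ] ℝ) = fderiv ℝ g (extChartAt I p p) := by
  have h : MDifferentiableAt I 𝓘(ℝ, ℝ) f p := hf.mdifferentiableAt (by simp)
  have h1 : fderivWithin ℝ (writtenInExtChartAt I 𝓘(ℝ, ℝ) p f) (range I) (extChartAt I p p)
      = fderiv ℝ g (extChartAt I p p) := by
    rw [I.range_eq_univ, fderivWithin_univ, ← hg.fderiv_eq]
    rfl
  ext v
  refine Eq.trans ?_ (congrArg (fun l : E →L[ℝ] ℝ => l v) h1)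
  exact congrArg (fun l : TangentSpace I p →L[ℝ] TangentSpace 𝓘(ℝ, ℝ) (f p) => l v) h.mfderiv

/-- On a finite-dimensional Hausdorff manifold every covector is the differential of a
smooth function. -/
theorem exists_differential_eq [FiniteDimensional ℝ E] [I.Boundaryless] [IsManifold I ∞ M]
    [T2Space M] (p : M) (l : TangentSpace I p →L[ℝ] ℝ) :
    ∃ f : C^∞⟮I, M; ℝ⟯, differential I f p = l := by
  obtain ⟨χ⟩ : Nonempty (SmoothBumpFunction I p) := inferInstance
  let l' : E →L[ℝ] ℝ := l
  have hs : ContMDiff I 𝓘(ℝ, ℝ) ∞ (fun x => χ x • l' (extChartAt I p x)) :=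
    χ.contMDiff_smul (l'.contDiff.contMDiff.comp_contMDiffOn contMDiffOn_extChartAt)
  refine ⟨⟨_, hs⟩, ?_⟩
  have := differential_eq_fderiv I (p := p) hs (g := l') (by
    filter_upwards [χ.toContDiffBump.eventuallyEq_one,
      (isOpen_extChartAt_target (I := I) p).mem_nhds (mem_extChartAt_target p)] with z hz hz'
    have e1 : χ ((extChartAt I p).symm z) = 1 := by
      rw [χ.eqOn_source (by rw [← extChartAt_source I]; exact (extChartAt I p).map_target hz')]
      simp only [Function.comp_apply, (extChartAt I p).right_inv hz']
      exact hz
    simp only [Function.comp_apply, e1, one_smul, (extChartAt I p).right_inv hz'])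
  exact this.trans l'.fderiv

/-- A point derivation of the algebra of smooth functions of a finite-dimensional Hausdorff
manifold is the derivative along a unique tangent vector. -/
theorem exists_tangentVector_of_derivation [FiniteDimensional ℝ E] [I.Boundaryless]
    [IsManifold I ∞ M] [T2Space M] (p : M) (D : C^∞⟮I, M; ℝ⟯ →ₗ[ℝ] ℝ)
    (hD : ∀ f g : C^∞⟮I, M; ℝ⟯, D (f * g) = f p * D g + g p * D f) :
    ∃ v : TangentSpace I p, ∀ f : C^∞⟮I, M; ℝ⟯, differential I f p v = D f := by
  obtain ⟨χ⟩ : Nonempty (SmoothBumpFunction I p) := inferInstance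
  let y : E := extChartAt I p p
  let b := Module.finBasis ℝ E
  let X : C^∞⟮I, M; ℝ⟯ := ⟨χ, χ.contMDiff⟩
  let dd : C^∞⟮I, M; ℝ⟯ → (E →L[ℝ] ℝ) := fun f => differential I f p
  have hX : X p = 1 := χ.eq_one
  let c : Fin (Module.finrank ℝ E) → E →L[ℝ] ℝ := fun i => (b.coord i).toContinuousLinearMap
  let x : Fin (Module.finrank ℝ E) → C^∞⟮I, M; ℝ⟯ := fun i =>
    ⟨fun z => χ z • c i (extChartAt I p z - y), χ.contMDiff_smul (by
      have : ContDiff ℝ ∞ fun z : E => c i (z - y) := by fun_prop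
      exact this.contMDiff.comp_contMDiffOn contMDiffOn_extChartAt)⟩
  have hx : ∀ i, x i p = 0 := fun i => by simp [x, y]
  let v : E := ∑ i, D (x i) • b i
  have hD1 : D 1 = 0 := by
    have := hD 1 1
    simp at this
    exact this
  have key : ∀ f : C^∞⟮I, M; ℝ⟯, D f = (dd f) v - f p * D X := by
    intro f
    let F : E → ℝ := fun z => χ.toContDiffBump z * f ((extChartAt I p).symm z)
    have hF : ContDiff ℝ ∞ F := by
      rw [contDiff_iff_contDiffAt]
      intro z
      by_cases hz : z ∈ tsupport χ.toContDiffBump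
      · have ht : z ∈ (extChartAt I p).target := by
          rw [χ.toContDiffBump.tsupport_eq] at hz
          exact χ.closedBall_subset ⟨hz, by simp [I.range_eq_univ]⟩
        have h1 : ContMDiffAt 𝓘(ℝ, E) 𝓘(ℝ, ℝ) ∞ (f ∘ (extChartAt I p).symm) z :=
          f.contMDiff.contMDiffAt.comp z ((contMDiffOn_extChartAt_symm p).contMDiffAt
            ((isOpen_extChartAt_target (I := I) p).mem_nhds ht))
        exact χ.toContDiffBump.contDiffAt.mul h1.contDiffAt
      · have h0 : F =ᶠ[𝓝 z] fun _ => 0 := by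
          filter_upwards [(isClosed_tsupport _).isOpen_compl.mem_nhds hz] with w hw
          simp only [F, image_eq_zero_of_notMem_tsupport hw, zero_mul]
        exact contDiffAt_const.congr_of_eventuallyEq h0
    have hFd : dd f = fderiv ℝ F y := by
      apply differential_eq_fderiv I f.contMDiff
      filter_upwards [χ.toContDiffBump.eventuallyEq_one] with z hz
      simp only [Pi.one_apply] at hz
      simp only [F, hz, one_mul, Function.comp_apply]
    obtain ⟨g, hg, hgy, hfg⟩ := exists_smooth_taylor_remainder hF y
    let h : Fin (Module.finrank ℝ E) → C^∞⟮I, M; ℝ⟯ := fun i =>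
      ⟨fun z => χ z • g (extChartAt I p z) (b i), χ.contMDiff_smul (by
        have : ContDiff ℝ ∞ fun z : E => g z (b i) := by fun_prop
        exact this.contMDiff.comp_contMDiffOn contMDiffOn_extChartAt)⟩
    have hh : ∀ i, h i p = (dd f) (b i) := fun i => by
      rw [hFd, ← hgy]
      have : h i p = χ p * g y (b i) := rfl
      simp only [this, χ.eq_one, one_mul]
    have hid : X * X * (X * f) = f p • (X * X) + ∑ i, x i * h i := by
      ext z
      by_cases hz : z ∈ (chartAt H p).source
      · have e1 : χ z = χ.toContDiffBump (extChartAt I p z) := χ.eqOn_source hz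
        have e2 : F (extChartAt I p z) = χ z * f z := by
          simp only [F, e1]
          rw [(extChartAt I p).left_inv (by rwa [extChartAt_source])]
        have e3 : F y = f p := by
          have : χ.toContDiffBump y = 1 := χ.toContDiffBump.eventuallyEq_one.eq_of_nhds
          simp only [F, this, one_mul, y, extChartAt_to_inv]
        have e4 := hfg (extChartAt I p z)
        have e5 : ∑ i, c i (extChartAt I p z - y) * g (extChartAt I p z) (b i)
            = g (extChartAt I p z) (extChartAt I p z - y) := by
          conv_rhs => rw [← b.sum_repr (extChartAt I p z - y)]
          simp [c]
        have e6 : (∑ i, x i * h i) z = χ z * χ z *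
            ∑ i, c i (extChartAt I p z - y) * g (extChartAt I p z) (b i) := by
          have : (∑ i, x i * h i) z = ∑ i, x i z * h i z := by
            exact map_sum (ContMDiffMap.evalRingHom (I := I) (n := ∞) (R := ℝ) z) (fun i => x i * h i) Finset.univ
          rw [this, Finset.mul_sum]
          refine Finset.sum_congr rfl fun i _ => ?_
          have e7 : x i z = χ z * c i (extChartAt I p z - y) := rfl
          have e8 : h i z = χ z * g (extChartAt I p z) (b i) := rfl
          rw [e7, e8]; ring
        have e9 : (X * X * (X * f)) z = χ z * χ z * (χ z * f z) := rfl
        have e10 : (f p • (X * X) + ∑ i, x i * h i) z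
            = f p * (χ z * χ z) + (∑ i, x i * h i) z := rfl
        rw [e9, e10, e6, e5, ← e2, e4, e3]; ring
      · have : χ z = 0 := by
          rw [χ.coe_def]; simp [hz]
        have e6 : (∑ i, x i * h i) z = 0 := by
          have h1 : (∑ i, x i * h i) z = ∑ i, x i z * h i z := by
            exact map_sum (ContMDiffMap.evalRingHom (I := I) (n := ∞) (R := ℝ) z) (fun i => x i * h i) Finset.univ
          rw [h1]
          refine Finset.sum_eq_zero fun i _ => ?_
          have e7 : x i z = χ z * c i (extChartAt I p z - y) := rfl
          rw [e7, this]; ring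
        have e9 : (X * X * (X * f)) z = χ z * χ z * (χ z * f z) := rfl
        have e10 : (f p • (X * X) + ∑ i, x i * h i) z
            = f p * (χ z * χ z) + (∑ i, x i * h i) z := rfl
        rw [e9, e10, e6, this]; ring
    have e := congrArg D hid
    have e11 : (X * X) p = 1 := by
      have : (X * X) p = X p * X p := rfl
      rw [this, hX]; ring
    have e12 : (X * f) p = f p := by
      have : (X * f) p = X p * f p := rfl
      rw [this, hX]; ring
    simp only [map_add, map_sum, map_smul, hD, hX, hx, hh, smul_eq_mul, e11, e12] at e
    have e13 : (dd f) v =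
        ∑ i, (dd f) (b i) * D (x i) := by
      simp only [v, map_sum, map_smul, smul_eq_mul]
      exact Finset.sum_congr rfl fun i _ => mul_comm _ _
    rw [e13]
    simp only [zero_mul, zero_add] at e
    linarith
  have hDX : D X = 0 := by
    have h1 := key 1
    have h2 : dd 1 = 0 := by
      refine (differential_eq_fderiv I (1 : C^∞⟮I, M; ℝ⟯).contMDiff (g := fun _ => 1)
        (Filter.Eventually.of_forall fun _ => rfl)).trans ?_
      exact fderiv_const_apply 1
    have h3 : (1 : C^∞⟮I, M; ℝ⟯) p = 1 := rfl
    rw [h2, hD1, h3] at h1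
    simpa using h1
  refine ⟨v, fun f => ?_⟩
  rw [key f, hDX, mul_zero, sub_zero]
  rfl

end Differential

section Poisson

variable {E : Type*} [NormedAddCommGroup E] [NormedSpace ℝ E]
  {H : Type*} [TopologicalSpace H] (I : ModelWithCorners ℝ E H)
  (M : Type*) [TopologicalSpace M] [ChartedSpace H M]

/-- A Poisson structure on `M`: a Lie bracket on the smooth functions of `M` which is a
derivation in each argument. -/
structure PoissonStructure where
  /-- The Poisson bracket `{f, g}`. -/
  bracket : C^∞⟮I, M; ℝ⟯ →ₗ[ℝ] C^∞⟮I, M; ℝ⟯ →ₗ[ℝ] C^∞⟮I, M; ℝ⟯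
  skew : ∀ f g, bracket f g = -bracket g f
  leibniz : ∀ f g h, bracket f (g * h) = bracket f g * h + g * bracket f h
  jacobi : ∀ f g h, bracket f (bracket g h) + bracket g (bracket h f)
    + bracket h (bracket f g) = 0

variable {I M}

/-- The value `X_g(p)` of the Hamiltonian vector field of `g`, i.e. the tangent vector at `p`
with `X_g(p)(f) = {f, g}(p)` for every smooth `f`. It exists and is unique on finite-dimensional
Hausdorff manifolds, see `PoissonStructure.differential_hamiltonianVectorField` and
`PoissonStructure.eq_hamiltonianVectorField`. -/
noncomputable def PoissonStructure.hamiltonianVectorField (P : PoissonStructure I M)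
    (g : C^∞⟮I, M; ℝ⟯) (p : M) : TangentSpace I p :=
  Classical.epsilon fun v => ∀ f : C^∞⟮I, M; ℝ⟯, differential I f p v = P.bracket f g p

/-- The bundle map `♯ : T*M → TM` of a Poisson structure, determined by `♯(d_p g) = X_g(p)`, see
`PoissonStructure.sharp_differential`. -/
noncomputable def PoissonStructure.sharp (P : PoissonStructure I M) (p : M)
    (l : TangentSpace I p →L[ℝ] ℝ) : TangentSpace I p :=
  P.hamiltonianVectorField (Classical.epsilon fun g : C^∞⟮I, M; ℝ⟯ => differential I g p = l) p

section WellDefined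

variable [FiniteDimensional ℝ E] [I.Boundaryless] [IsManifold I ∞ M] [T2Space M]

theorem PoissonStructure.differential_hamiltonianVectorField (P : PoissonStructure I M)
    (f g : C^∞⟮I, M; ℝ⟯) (p : M) :
    differential I f p (P.hamiltonianVectorField g p) = P.bracket f g p := by
  let D : C^∞⟮I, M; ℝ⟯ →ₗ[ℝ] ℝ :=
    { toFun := fun f => P.bracket f g p
      map_add' := fun a b => by rw [map_add]; rfl
      map_smul' := fun a b => by rw [map_smul]; rfl }
  have hD : ∀ a b : C^∞⟮I, M; ℝ⟯, D (a * b) = a p * D b + b p * D a := by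
    intro a b
    have h1 : P.bracket (a * b) g = a * P.bracket b g + b * P.bracket a g := by
      rw [P.skew (a * b) g, P.leibniz, P.skew g a, P.skew g b]; ring
    have h2 := congrArg (fun F : C^∞⟮I, M; ℝ⟯ => F p) h1
    exact h2
  exact Classical.epsilon_spec (exists_tangentVector_of_derivation I p D hD) f

theorem PoissonStructure.eq_hamiltonianVectorField (P : PoissonStructure I M)
    (g : C^∞⟮I, M; ℝ⟯) (p : M) (v : TangentSpace I p)
    (hv : ∀ f : C^∞⟮I, M; ℝ⟯, differential I f p v = P.bracket f g p) :
    v = P.hamiltonianVectorField g p := by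
  have h : ∀ l : E →L[ℝ] ℝ, l v = l (P.hamiltonianVectorField g p) := by
    intro l
    obtain ⟨f, hf⟩ := exists_differential_eq I p (l : TangentSpace I p →L[ℝ] ℝ)
    have h1 := (hv f).trans (P.differential_hamiltonianVectorField f g p).symm
    rw [hf] at h1
    exact h1
  exact SeparatingDual.eq_iff_forall_dual_eq (R := ℝ) (V := E) |>.2 h

theorem PoissonStructure.sharp_differential (P : PoissonStructure I M)
    (g : C^∞⟮I, M; ℝ⟯) (p : M) :
    P.sharp p (differential I g p) = P.hamiltonianVectorField g p := by
  apply P.eq_hamiltonianVectorField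
  intro f
  rw [PoissonStructure.sharp, P.differential_hamiltonianVectorField, P.skew, P.skew f g]
  have h := Classical.epsilon_spec (p := fun g' : C^∞⟮I, M; ℝ⟯ =>
    differential I g' p = differential I g p) ⟨g, rfl⟩
  have h1 := P.differential_hamiltonianVectorField (Classical.epsilon fun g' : C^∞⟮I, M; ℝ⟯ =>
    differential I g' p = differential I g p) f p
  have h2 := P.differential_hamiltonianVectorField g f p
  rw [h] at h1
  exact congrArg Neg.neg (h1.symm.trans h2)

end WellDefined

end Poisson

section Coisotropic

variable {E : Type*} [NormedAddCommGroup E] [NormedSpace ℝ E]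
  {H : Type*} [TopologicalSpace H] (I : ModelWithCorners ℝ E H)
  {M : Type*} [TopologicalSpace M] [ChartedSpace H M]
  {F : Type*} [NormedAddCommGroup F] [NormedSpace ℝ F]
  {K : Type*} [TopologicalSpace K] (J : ModelWithCorners ℝ F K)
  {N : Type*} [TopologicalSpace N] [ChartedSpace K N]

/-- The tangent space `T_p S` of a submanifold `S` of `M` at `p`: the set of velocities at `p` of
the smooth curves of `M` that lie in `S`. -/
def tangentSpaceOf (S : Set M) (p : M) : Set (TangentSpace I p) :=
  {v | ∃ (γ : ℝ → M) (δ : ℝ), 0 < δ ∧ ContMDiffOn 𝓘(ℝ, ℝ) I ∞ γ (Ioo (-δ) δ) ∧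
    MapsTo γ (Ioo (-δ) δ) S ∧
    tangentMap 𝓘(ℝ, ℝ) I γ (⟨0, (1 : ℝ)⟩ : TangentBundle 𝓘(ℝ, ℝ) ℝ) = ⟨p, v⟩}

/-- A submanifold `S` of `M` is coisotropic for the bundle map `σ : T*M → TM` of a
Poisson structure if `σ` maps the annihilator of `T_p S` into `T_p S` for all `p ∈ S`. -/
def IsCoisotropic (σ : ∀ p : M, (TangentSpace I p →L[ℝ] ℝ) → TangentSpace I p)
    (S : Set M) : Prop :=
  ∀ p ∈ S, ∀ l : TangentSpace I p →L[ℝ] ℝ, (∀ v ∈ tangentSpaceOf I S p, l v = 0) →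
    σ p l ∈ tangentSpaceOf I S p

variable {I J}

/-- The bundle map `T*(M × N) → T(M × N)` of the product of two Poisson structures with
bundle maps `σ` and `τ`. Here `T_(p,q)(M × N) = T_p M × T_q N`. -/
noncomputable def sharpProd (σ : ∀ p : M, (TangentSpace I p →L[ℝ] ℝ) → TangentSpace I p)
    (τ : ∀ q : N, (TangentSpace J q →L[ℝ] ℝ) → TangentSpace J q) (z : M × N)
    (l : TangentSpace (I.prod J) z →L[ℝ] ℝ) : TangentSpace (I.prod J) z :=
  let l' : TangentSpace I z.1 × TangentSpace J z.2 →L[ℝ] ℝ := l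
  (σ z.1 (l'.comp (ContinuousLinearMap.inl ℝ (TangentSpace I z.1) (TangentSpace J z.2))),
    τ z.2 (l'.comp (ContinuousLinearMap.inr ℝ (TangentSpace I z.1) (TangentSpace J z.2))))

end Coisotropic

section Groupoid

variable {E : Type*} [NormedAddCommGroup E] [NormedSpace ℝ E]
  {H : Type*} [TopologicalSpace H] (I : ModelWithCorners ℝ E H)
  {F : Type*} [NormedAddCommGroup F] [NormedSpace ℝ F]
  {K : Type*} [TopologicalSpace K] (J : ModelWithCorners ℝ F K)
  (Γ : Type*) [TopologicalSpace Γ] [ChartedSpace H Γ]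
  (Q : Type*) [TopologicalSpace Q] [ChartedSpace K Q]

/-- A Lie groupoid `Γ ⇉ Q`. The multiplication is only meaningful on the set
`Γ₂ = {(g, h) | β g = α h}` of composable pairs: `mul` has arbitrary values elsewhere. As `Γ₂` is
an embedded submanifold of `Γ × Γ`, smoothness of `ν : Γ₂ → Γ` is smoothness on the
subset `Γ₂` of `Γ × Γ`. -/
structure LieGroupoid where
  /-- The source map `α`. -/
  source : Γ → Q
  /-- The target map `β`. -/
  target : Γ → Q
  /-- The identity section `ε`. -/
  unit : Q → Γ
  /-- The inversion `ι`. -/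
  inv : Γ → Γ
  /-- The multiplication `ν`. -/
  mul : Γ → Γ → Γ
  source_unit : ∀ q, source (unit q) = q
  target_unit : ∀ q, target (unit q) = q
  source_inv : ∀ g, source (inv g) = target g
  target_inv : ∀ g, target (inv g) = source g
  source_mul : ∀ g h, target g = source h → source (mul g h) = source g
  target_mul : ∀ g h, target g = source h → target (mul g h) = target h
  mul_assoc : ∀ g h k, target g = source h → target h = source k →
    mul g (mul h k) = mul (mul g h) k
  unit_mul : ∀ g, mul (unit (source g)) g = g
  mul_unit : ∀ g, mul g (unit (target g)) = g
  inv_mul : ∀ g, mul (inv g) g = unit (target g)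
  mul_inv : ∀ g, mul g (inv g) = unit (source g)
  source_submersion : Manifold.IsSubmersion I J ∞ source
  target_submersion : Manifold.IsSubmersion I J ∞ target
  smooth_unit : ContMDiff J I ∞ unit
  smooth_inv : ContMDiff I I ∞ inv
  smooth_mul : ContMDiffOn (I.prod I) I ∞ (fun z : Γ × Γ => mul z.1 z.2)
    {z | target z.1 = source z.2}

variable {Γ Q}

/-- The graph of the multiplication, `{(g, h, g h) | (g, h) ∈ Γ₂} ⊆ Γ × Γ × Γ`. -/
def LieGroupoid.mulGraph {I : ModelWithCorners ℝ E H} {J : ModelWithCorners ℝ F K}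
    (G : LieGroupoid I J Γ Q) : Set (Γ × Γ × Γ) :=
  {z | G.target z.1 = G.source z.2.1 ∧ z.2.2 = G.mul z.1 z.2.1}

variable (Γ Q)

/-- A Poisson groupoid `Γ ⇉ Q`: a Lie groupoid with a Poisson structure on `Γ` such that the graph
of the multiplication is coisotropic in `Γ × Γ × Γ⁻`, where `Γ⁻` is `Γ` with the negative
Poisson structure. -/
structure PoissonGroupoid extends LieGroupoid I J Γ Q where
  /-- The Poisson structure of `Γ`. -/
  poisson : PoissonStructure I Γ
  coisotropic_mulGraph : IsCoisotropic (I.prod (I.prod I))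
    (sharpProd poisson.sharp (sharpProd poisson.sharp fun g l => -poisson.sharp g l))
    toLieGroupoid.mulGraph

end Groupoid

section Velocity

variable {E : Type*} [NormedAddCommGroup E] [NormedSpace ℝ E]
  {H : Type*} [TopologicalSpace H] (I : ModelWithCorners ℝ E H)
  {M : Type*} [TopologicalSpace M] [ChartedSpace H M]
  {F : Type*} [NormedAddCommGroup F] [NormedSpace ℝ F]
  {K : Type*} [TopologicalSpace K] (J : ModelWithCorners ℝ F K)
  {N : Type*} [TopologicalSpace N] [ChartedSpace K N]

/-- The curve `γ` passes through `p` at time `0` with velocity `v`. -/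
def HasVelocity (γ : ℝ → M) (p : M) (v : E) : Prop :=
  γ 0 = p ∧ HasMFDerivAt 𝓘(ℝ, ℝ) I γ 0 (ContinuousLinearMap.toSpanSingleton ℝ v)

variable {I J}

theorem HasVelocity.unique {γ γ' : ℝ → M} {p : M} {v v' : E}
    (h : HasVelocity I γ p v) (h' : HasVelocity I γ' p v') (heq : γ =ᶠ[𝓝 0] γ') : v = v' := by
  obtain ⟨rfl, h⟩ := h
  have h1 := hasMFDerivAt_unique h (h'.2.congr_of_eventuallyEq heq)
  have h2 := congrArg (fun l : ℝ →L[ℝ] E => l 1) h1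
  exact (one_smul ℝ v).symm.trans (h2.trans (one_smul ℝ v'))

theorem HasVelocity.comp {γ : ℝ → M} {p : M} {v : E} (h : HasVelocity I γ p v)
    {f : M → N} {S : Set M} {L : E →L[ℝ] F}
    (hf : HasMFDerivWithinAt I J f S p L) (hS : ∀ᶠ t in 𝓝 0, γ t ∈ S) :
    HasVelocity J (fun t => f (γ t)) (f p) (L v) := by
  obtain ⟨rfl, h⟩ := h
  refine ⟨rfl, ?_⟩
  have h1 := (HasMFDerivWithinAt.comp (s := {t | γ t ∈ S}) 0 hf h.hasMFDerivWithinAt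
    fun _ ht => ht).hasMFDerivAt hS
  refine HasMFDerivAt.congr_mfderiv h1 (ContinuousLinearMap.ext_ring (R₁ := ℝ) ?_)
  change L ((1 : ℝ) • v) = (1 : ℝ) • L v
  exact map_smul L _ _

theorem HasVelocity.prodMk {γ : ℝ → M} {γ' : ℝ → N} {p : M} {p' : N} {v : E}
    {v' : F} (h : HasVelocity I γ p v) (h' : HasVelocity J γ' p' v') :
    HasVelocity (I.prod J) (fun t => (γ t, γ' t)) (p, p') (v, v') := by
  refine ⟨Prod.ext h.1 h'.1, ?_⟩
  exact HasMFDerivAt.congr_mfderiv (h.2.prodMk h'.2) (ContinuousLinearMap.ext_ring (R₁ := ℝ) rfl)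

theorem HasVelocity.fst {γ : ℝ → M × N} {p : M × N} {v : E × F}
    (h : HasVelocity (I.prod J) γ p v) :
    HasVelocity I (fun t => (γ t).1) p.1 (v.1) :=
  h.comp (hasMFDerivAt_fst (I := I) (I' := J) p).hasMFDerivWithinAt (L := .fst ℝ E F)
    (S := univ) (Filter.Eventually.of_forall fun _ => mem_univ _)

theorem HasVelocity.snd {γ : ℝ → M × N} {p : M × N} {v : E × F}
    (h : HasVelocity (I.prod J) γ p v) :
    HasVelocity J (fun t => (γ t).2) p.2 (v.2) :=
  h.comp (hasMFDerivAt_snd (I := I) (I' := J) p).hasMFDerivWithinAt (L := .snd ℝ E F)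
    (S := univ) (Filter.Eventually.of_forall fun _ => mem_univ _)

theorem mem_tangentSpaceOf_iff {S : Set M} {p : M} {v : TangentSpace I p} :
    v ∈ tangentSpaceOf I S p ↔ ∃ (γ : ℝ → M) (δ : ℝ), 0 < δ ∧
      ContMDiffOn 𝓘(ℝ, ℝ) I ∞ γ (Ioo (-δ) δ) ∧ MapsTo γ (Ioo (-δ) δ) S ∧
      HasVelocity I γ p v := by
  refine exists₂_congr fun γ δ => and_congr_right fun hδ => and_congr_right fun hγ =>
    and_congr_right fun _ => ?_
  have hd : MDifferentiableAt 𝓘(ℝ, ℝ) I γ 0 :=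
    (hγ.contMDiffAt (Ioo_mem_nhds (by linarith) hδ)).mdifferentiableAt (by simp)
  constructor
  · intro h
    obtain rfl : γ 0 = p := congrArg Bundle.TotalSpace.proj h
    refine ⟨rfl, HasMFDerivAt.congr_mfderiv hd.hasMFDerivAt ?_⟩
    have h1 : mfderiv 𝓘(ℝ, ℝ) I γ 0 (1 : ℝ) = v := by
      simpa only [tangentMap, Bundle.TotalSpace.mk_inj] using h
    exact ContinuousLinearMap.ext_ring (R₁ := ℝ) (h1.trans (one_smul ℝ (v : E)).symm)
  · rintro ⟨rfl, h⟩
    have h1 : mfderiv 𝓘(ℝ, ℝ) I γ 0 (1 : ℝ) = v := by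
      rw [h.mfderiv]
      exact one_smul ℝ (v : E)
    simp only [tangentMap]
    rw [h1]

theorem HasVelocity.differential {γ : ℝ → M} {p : M} {v : E}
    (h : HasVelocity I γ p v) {f : M → ℝ} (hf : MDifferentiableAt I 𝓘(ℝ, ℝ) f p) :
    HasVelocity 𝓘(ℝ, ℝ) (fun t => f (γ t)) (f p) (differential I f p v) :=
  h.comp hf.hasMFDerivAt.hasMFDerivWithinAt
    (S := univ) (Filter.Eventually.of_forall fun _ => mem_univ _)

theorem hasVelocity_const (p : M) : HasVelocity I (fun _ => p) p 0 := by
  refine ⟨rfl, HasMFDerivAt.congr_mfderiv (hasMFDerivAt_const p (0 : ℝ))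
    (ContinuousLinearMap.ext_ring (R₁ := ℝ) (one_smul ℝ (0 : E)).symm)⟩

end Velocity

theorem PoissonStructure.sharp_neg_differential
    {E : Type*} [NormedAddCommGroup E] [NormedSpace ℝ E] [FiniteDimensional ℝ E]
    {H : Type*} [TopologicalSpace H] {I : ModelWithCorners ℝ E H} [I.Boundaryless]
    {M : Type*} [TopologicalSpace M] [ChartedSpace H M] [IsManifold I ∞ M] [T2Space M]
    (P : PoissonStructure I M) (g : C^∞⟮I, M; ℝ⟯) (p : M) :
    P.sharp p (-differential I g p) = -P.hamiltonianVectorField g p := by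
  have hneg : differential I (-g : C^∞⟮I, M; ℝ⟯) p = -differential I g p := by
    have h := (g.contMDiff.mdifferentiableAt (x := p) (by simp)).hasMFDerivAt.neg
    ext v
    exact congrArg (fun l : E →L[ℝ] ℝ => l v) h.mfderiv
  rw [← hneg, P.sharp_differential]
  refine (P.eq_hamiltonianVectorField _ _ _ fun f => ?_).symm
  rw [map_neg, map_neg, P.differential_hamiltonianVectorField]
  rfl

section Groupoid

variable {E : Type*} [NormedAddCommGroup E] [NormedSpace ℝ E]
  {H : Type*} [TopologicalSpace H] {I : ModelWithCorners ℝ E H}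
  {F : Type*} [NormedAddCommGroup F] [NormedSpace ℝ F]
  {K : Type*} [TopologicalSpace K] {J : ModelWithCorners ℝ F K}
  {Γ : Type*} [TopologicalSpace Γ] [ChartedSpace H Γ]
  {Q : Type*} [TopologicalSpace Q] [ChartedSpace K Q]

theorem LieGroupoid.unit_mul_unit (G : LieGroupoid I J Γ Q) (q : Q) :
    G.mul (G.unit q) (G.unit q) = G.unit q := by
  simpa [G.source_unit] using G.unit_mul (G.unit q)

theorem LieGroupoid.inv_unit (G : LieGroupoid I J Γ Q) (q : Q) :
    G.inv (G.unit q) = G.unit q := by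
  have h1 := G.mul_unit (G.inv (G.unit q))
  rw [G.target_inv, G.source_unit] at h1
  rw [← h1, G.inv_mul, G.target_unit]

/-- At a unit, the derivative of the multiplication is `(u, v) ↦ u + v - dε (dβ u)`. -/
theorem LieGroupoid.exists_eq_add_sub_of_mem_tangentSpaceOf_mulGraph
    [IsManifold I ∞ Γ] [IsManifold J ∞ Q]
    (G : LieGroupoid I J Γ Q) (q : Q) {u v w : E}
    (h : ((u, v, w) : E × E × E) ∈ tangentSpaceOf (I.prod (I.prod I)) G.mulGraph
      (G.unit q, G.unit q, G.unit q)) :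
    ∃ z : E, z ∈ tangentSpaceOf I (range G.unit) (G.unit q) ∧ w = u + v - z := by
  obtain ⟨γ, δ, hδ, hγ, hmaps, hvel⟩ := mem_tangentSpaceOf_iff.1 h
  have hnhds : ∀ᶠ t in 𝓝 (0 : ℝ), γ t ∈ G.mulGraph := by
    filter_upwards [Ioo_mem_nhds (neg_lt_zero.2 hδ) hδ] with t ht using hmaps ht
  have hu : HasVelocity I (fun t => (γ t).1) (G.unit q) u := hvel.fst
  have hv : HasVelocity I (fun t => (γ t).2.1) (G.unit q) v := hvel.snd.fst
  have hw : HasVelocity I (fun t => (γ t).2.2) (G.unit q) w := hvel.snd.snd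
  have hβ : ContMDiff I J ∞ G.target := G.target_submersion.contMDiff
  have hεβ : ContMDiff I I ∞ (fun g => G.unit (G.target g)) := G.smooth_unit.comp hβ
  obtain ⟨z, hz⟩ : ∃ z : E, HasVelocity I (fun t => G.unit (G.target (γ t).1)) (G.unit q) z := by
    have h1 := hu.comp (f := fun g => G.unit (G.target g)) (hεβ.mdifferentiableAt (x := G.unit q)
      (by simp)).hasMFDerivAt.hasMFDerivWithinAt
      (S := univ) (Filter.Eventually.of_forall fun _ => mem_univ _)
    rw [G.target_unit] at h1
    exact ⟨_, h1⟩
  refine ⟨z, mem_tangentSpaceOf_iff.2 ⟨_, δ, hδ, ?_, fun t _ => mem_range_self _, hz⟩, ?_⟩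
  · exact hεβ.comp_contMDiffOn (contMDiff_fst.comp_contMDiffOn hγ)
  have hunit : (G.unit q, G.unit q) ∈ {z : Γ × Γ | G.target z.1 = G.source z.2} := by
    simp [G.target_unit, G.source_unit]
  obtain ⟨L, hL⟩ : ∃ L : E × E →L[ℝ] E, ∀ (c c' : ℝ → Γ) (a a' b : E),
      HasVelocity I c (G.unit q) a → HasVelocity I c' (G.unit q) a' →
      (∀ᶠ t in 𝓝 (0 : ℝ), G.target (c t) = G.source (c' t)) →
      ∀ c'' : ℝ → Γ, HasVelocity I c'' (G.unit q) b →
      (∀ᶠ t in 𝓝 (0 : ℝ), c'' t = G.mul (c t) (c' t)) → b = L (a, a') := by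
    have hd := ((G.smooth_mul _ hunit).mdifferentiableWithinAt (by simp)).hasMFDerivWithinAt
    refine ⟨mfderivWithin (I.prod I) I (fun z : Γ × Γ => G.mul z.1 z.2)
      {z | G.target z.1 = G.source z.2} (G.unit q, G.unit q),
      fun c c' a a' b ha ha' hcc c'' hb hc => ?_⟩
    have h1 := (ha.prodMk ha').comp hd hcc
    rw [G.unit_mul_unit] at h1
    exact hb.unique h1 hc
  have e1 : w = L (u, v) := hL _ _ _ _ _ hu hv (hnhds.mono fun t ht => ht.1) _ hw
    (hnhds.mono fun t ht => ht.2)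
  have e2 : u = L (u, z) := hL _ _ _ _ _ hu hz
    (Filter.Eventually.of_forall fun t => (G.source_unit _).symm) _ hu
    (Filter.Eventually.of_forall fun t => (G.mul_unit _).symm)
  have e3 : v = L (z, v) := hL _ _ _ _ _ hz hv
    (hnhds.mono fun t ht => (G.target_unit _).trans ht.1) _ hv
    (hnhds.mono fun t ht => by rw [ht.1, G.unit_mul])
  have e4 : z = L (z, z) := hL _ _ _ _ _ hz hz
    (Filter.Eventually.of_forall fun t => by rw [G.target_unit, G.source_unit]) _ hz
    (Filter.Eventually.of_forall fun t => (G.unit_mul_unit _).symm)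
  have e5 : ((u, v) : E × E) = (u, z) + (z, v) - (z, z) := by simp
  rw [e1, e5, map_sub, map_add, ← e2, ← e3, ← e4]

end Groupoid

theorem mainTheorem7
    {E : Type*} [NormedAddCommGroup E] [NormedSpace ℝ E] [FiniteDimensional ℝ E]
    {H : Type*} [TopologicalSpace H] (I : ModelWithCorners ℝ E H) [I.Boundaryless]
    {F : Type*} [NormedAddCommGroup F] [NormedSpace ℝ F] [FiniteDimensional ℝ F]
    {K : Type*} [TopologicalSpace K] (J : ModelWithCorners ℝ F K) [J.Boundaryless]
    {Γ : Type*} [TopologicalSpace Γ] [ChartedSpace H Γ] [IsManifold I ∞ Γ] [T2Space Γ]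
    {Q : Type*} [TopologicalSpace Q] [ChartedSpace K Q] [IsManifold J ∞ Q]
    (G : PoissonGroupoid I J Γ Q) (e : C^∞⟮I, Γ; ℝ⟯) (he : ∀ g, e (G.inv g) = -e g) (q : Q) :
    G.poisson.hamiltonianVectorField e (G.unit q) ∈
      tangentSpaceOf I (Set.range G.unit) (G.unit q) := by
  set p := G.unit q with hp
  let X : E := G.poisson.hamiltonianVectorField e p
  let ξ : E →L[ℝ] ℝ := differential I e p
  have he0 : ∀ r, e (G.unit r) = 0 := fun r => by
    have := he (G.unit r)
    rw [G.inv_unit] at this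
    linarith
  have hξ : ∀ z ∈ tangentSpaceOf I (range G.unit) p, ξ z = 0 := by
    intro z hz
    obtain ⟨γ, δ, hδ, -, hmaps, hvel⟩ := mem_tangentSpaceOf_iff.1 hz
    have h1 := hvel.differential (e.contMDiff.mdifferentiableAt (by simp))
    have h2 : HasVelocity 𝓘(ℝ, ℝ) (fun _ : ℝ => (e p : ℝ)) (e p) 0 := hasVelocity_const _
    refine h1.unique h2 ?_
    filter_upwards [Ioo_mem_nhds (neg_lt_zero.2 hδ) hδ] with t ht
    obtain ⟨r, hr⟩ := hmaps ht
    rw [← hr, he0, hp, he0]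
  let l : E × E × E →L[ℝ] ℝ := ξ.coprod (ξ.coprod (-ξ))
  have hl : ∀ y ∈ tangentSpaceOf (I.prod (I.prod I)) G.mulGraph (p, p, p), l y = 0 := by
    rintro ⟨u, v, w⟩ h
    obtain ⟨z, hz, rfl⟩ := G.exists_eq_add_sub_of_mem_tangentSpaceOf_mulGraph q h
    have h1 := hξ z hz
    have h2 : l (u, v, u + v - z) = ξ u + (ξ v + -(ξ (u + v - z))) := by
      simp [l]
    refine h2.trans ?_
    rw [map_sub, map_add]
    linarith
  have hmem : (p, p, p) ∈ G.mulGraph :=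
    ⟨by simp [hp, G.target_unit, G.source_unit], (G.unit_mul_unit q).symm⟩
  have h1 := G.coisotropic_mulGraph (p, p, p) hmem l hl
  have h2 : sharpProd G.poisson.sharp (sharpProd G.poisson.sharp fun g l => -G.poisson.sharp g l)
      (p, p, p) l = ((X, X, X) : E × E × E) := by
    have hξ' : G.poisson.sharp p ξ = X := G.poisson.sharp_differential e p
    have hξn : -G.poisson.sharp p (-ξ) = X :=
      (congrArg Neg.neg (G.poisson.sharp_neg_differential e p)).trans (neg_neg X)
    have l1 : l.comp (ContinuousLinearMap.inl ℝ E (E × E)) = ξ := by ext; simp [l]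
    have l2 : (l.comp (ContinuousLinearMap.inr ℝ E (E × E))).comp
        (ContinuousLinearMap.inl ℝ E E) = ξ := by ext; simp [l]
    have l3 : (l.comp (ContinuousLinearMap.inr ℝ E (E × E))).comp
        (ContinuousLinearMap.inr ℝ E E) = -ξ := by ext; simp [l]
    refine Prod.ext ?_ (Prod.ext ?_ ?_)
    · exact (congrArg (G.poisson.sharp p) l1).trans hξ'
    · exact (congrArg (G.poisson.sharp p) l2).trans hξ'
    · exact (congrArg (fun m => -G.poisson.sharp p m) l3).trans hξn
  rw [h2] at h1
  obtain ⟨z, hz, hX⟩ := G.exists_eq_add_sub_of_mem_tangentSpaceOf_mulGraph q h1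
  have hXz : X = z := by
    have h3 : (X : E) = X + X - z := hX
    rwa [add_sub_assoc, left_eq_add, sub_eq_zero] at h3
  exact (show G.poisson.hamiltonianVectorField e p = z from hXz) ▸ hz
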